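/- **Setting.** An instance $I=(n,V,P,k,T)$ of the sequential hiring problem consists of applicants $1,\dots,n$ with values $v_i\ge 0$ and acceptance probabilities $p_i\in[0,1]$, of $k$ positions, and of $T\ge 1$ stages; applicants accept offers independently, applicant $i$ with probability $p_i$. A state is a triple $(t,k_t,A_t)$ (current stage, open positions, applicants still available); the process starts at $(1,k,[n])$, and a state is terminal if $t=T+1$, $k_t=0$ or $A_t=\emptyset$. A (deterministic, adaptive) *hiring policy* assigns to every non-terminal state an applicant $i\in A_t$, who gets the next offer; if $i$ accepts, the reward $v_i$ is collected and the next state is $(t+1,k_t-1,A_t\setminus\{i\})$, otherwise it is $(t+1,k_t,A_t\setminus\{i\})$. A *block-responsive policy* assigns to every non-terminal state an ordered set (block) $B\subseteq A_t$ with $t+|B|\le T+1$; offers are made along $B$ in order until the first acceptance. If some $i\in B$ accepts, the reward $v_i$ is collected and the next state is $(t+|B|,k_t-1,A_t\setminus B)$; if all reject, it is $(t+|B|,k_t,A_t\setminus B)$. Choosing $B=\emptyset$ means stopping. $\mathcal R^I(\cdot)$ denotes the expected total reward of a policy. The *decision tree* of a block-responsive policy is the binary tree whose root is the starting state, whose internal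 nodes have the two possible next states as children (left: all reject; right: some applicant accepts), and whose leaves are the terminal states and the states at which the policy stops; its depth is the largest number of arcs on a root-to-leaf path. **Rounded instance.** For $0<\epsilon<1$ let $\gamma=\epsilon/T$, $\mathcal C_0=\{i: p_i\le\gamma\}$, and $\mathcal C_m=\{i:(1+\epsilon)^{m-1}\gamma<p_i\le(1+\epsilon)^m\gamma\}$ for $m\ge1$. The mixed-rounded instance $I^{\updownarrow}=(n,V^{\updownarrow},P^{\updownarrow},k,T)$ has $p_i^{\updownarrow}=\gamma$ and $v_i^{\updownarrow}=v_ip_i/\gamma$ for $i\in\mathcal C_0$, and $p_i^{\updownarrow}=(1+\epsilon)^{m-1}\gamma$ and $v_i^{\updownarrow}=v_i$ for $i\in\mathcal C_m$, $m\ge1$. **Theorem.** There is an absolute constant $C$ such that for every instance $I$, every $0<\epsilon<1$ and every hiring policy $\mathcal H^*$ of maximum expected reward for $I^{\updownarrow}$ among all hiring policies, there exists a block-responsive policy $\mathcal H^B$ for $I^{\updownarrow}$ such that: 1. (Expected reward) $\mathcal R^{I^{\updownarrow}}(\mathcal H^B)\ \ge\ (1-4\epsilon^3k)\cdot\mathcal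 R^{I^{\updownarrow}}(\mathcal H^*)$. 2. (Size) The decision tree of $\mathcal H^B$ has at most $(1/\epsilon)^{Ck}$ nodes, and its depth is at most $C\,\frac{k}{\epsilon^3}\log\frac1\epsilon$. 3. (Block-order-by-value) At every non-terminal state $(t,k_t,A_t)$ and for every class $\mathcal C_m$, the $\mathcal C_m$-applicants of the block of $\mathcal H^B$ form a prefix of $A_t\cap\mathcal C_m$, listed by decreasing value $v^{\updownarrow}$ with ties broken by index. -/

import Mathlib

namespace SeqHiring

/-- An instance `(n, V, P, k, T)` of the sequential hiring problem: values `v_i`, acceptance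
probabilities `p_i`, the number `k` of positions and the number `T` of stages. -/
structure HiringInstance (n : ℕ) where
  value : Fin n → ℝ
  prob : Fin n → ℝ
  positions : ℕ
  horizon : ℕ

/-- Values are nonnegative and acceptance probabilities lie in `[0, 1]`. -/
structure HiringInstance.Valid {n : ℕ} (I : HiringInstance n) : Prop where
  value_nonneg : ∀ i, 0 ≤ I.value i
  prob_nonneg : ∀ i, 0 ≤ I.prob i
  prob_le_one : ∀ i, I.prob i ≤ 1

/-- States `(t, k_t, A_t)` at which a further offer can be made; all others are terminal. -/
abbrev NonTerminal {n : ℕ} (T t k : ℕ) (A : Finset (Fin n)) : Prop :=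
  t ≤ T ∧ 1 ≤ k ∧ A.Nonempty

/-- Expectation of `f(X_1, …, X_n)` for independent `X_i` with `X_i = true` (acceptance) with
probability `p_i`. -/
noncomputable def expectation {n : ℕ} (p : Fin n → ℝ) (f : (Fin n → Bool) → ℝ) : ℝ :=
  ∑ ω : Fin n → Bool, (∏ i, if ω i then p i else 1 - p i) * f ω

/-! ### Single-offer (adaptive) hiring policies -/

/-- An adaptive hiring policy: to a state `(t, k_t, A_t)` with `A_t ≠ ∅` it assigns an available
applicant, who receives the next offer. -/
def HiringPolicy (n : ℕ) : Type :=
  ℕ → ℕ → (A : Finset (Fin n)) → A.Nonempty → {i : Fin n // i ∈ A}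

/-- Cumulative reward collected from the state `(t, k, A)` on when the applicants' decisions
are `ω`. -/
noncomputable def HiringPolicy.sampleReward {n : ℕ} (H : HiringPolicy n) (v : Fin n → ℝ) (T : ℕ)
    (ω : Fin n → Bool) (t k : ℕ) (A : Finset (Fin n)) : ℝ :=
  if h : NonTerminal T t k A then
    if ω (H t k A h.2.2).1 then
      v (H t k A h.2.2).1 + H.sampleReward v T ω (t + 1) (k - 1) (A.erase (H t k A h.2.2).1)
    else
      H.sampleReward v T ω (t + 1) k (A.erase (H t k A h.2.2).1)
  else 0
termination_by T + 1 - t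
decreasing_by all_goals (have := h.1; omega)

/-- The total expected reward of a hiring policy, starting at the state `(1, k, [n])`. -/
noncomputable def HiringPolicy.expectedReward {n : ℕ} (H : HiringPolicy n)
    (I : HiringInstance n) : ℝ :=
  expectation I.prob fun ω => H.sampleReward I.value I.horizon ω 1 I.positions Finset.univ

/-- A hiring policy of maximum expected reward among all adaptive hiring policies. -/
def HiringPolicy.IsOptimal {n : ℕ} (H : HiringPolicy n) (I : HiringInstance n) : Prop :=
  ∀ H' : HiringPolicy n, H'.expectedReward I ≤ H.expectedReward I

/-! ### Block-responsive policies -/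

/-- A block-responsive policy with `T` stages: to every non-terminal state it assigns an ordered
set of available applicants (a list without repetitions) that fits into the remaining stages.
The empty block means that no further offers are made. -/
structure BlockPolicy (n T : ℕ) where
  block : ℕ → ℕ → Finset (Fin n) → List (Fin n)
  nodup : ∀ t k A, NonTerminal T t k A → (block t k A).Nodup
  available : ∀ t k A, NonTerminal T t k A → ∀ i ∈ block t k A, i ∈ A
  length_le : ∀ t k A, NonTerminal T t k A → t + (block t k A).length ≤ T + 1

/-- Cumulative reward collected from the state `(t, k, A)` on when the applicants' decisions
are `ω`: offers are made along the block up to the first acceptance (if any); in either case the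
whole block is removed and the time advances by its length. -/
noncomputable def BlockPolicy.sampleReward {n T : ℕ} (H : BlockPolicy n T) (v : Fin n → ℝ)
    (ω : Fin n → Bool) (t k : ℕ) (A : Finset (Fin n)) : ℝ :=
  if _h : NonTerminal T t k A ∧ H.block t k A ≠ [] then
    match (H.block t k A).find? (fun i => ω i) with
    | some i => v i + H.sampleReward v ω (t + (H.block t k A).length) (k - 1)
        (A \ (H.block t k A).toFinset)
    | none => H.sampleReward v ω (t + (H.block t k A).length) k (A \ (H.block t k A).toFinset)
  else 0
termination_by T + 1 - t
decreasing_by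
  all_goals
    have _h1 := _h.1.1
    have h2 := List.length_pos_iff.mpr _h.2
    omega

/-- The total expected reward of a block-responsive policy, starting at `(1, k, [n])`. -/
noncomputable def BlockPolicy.expectedReward {n : ℕ} (I : HiringInstance n)
    (H : BlockPolicy n I.horizon) : ℝ :=
  expectation I.prob fun ω => H.sampleReward I.value ω 1 I.positions Finset.univ

/-- Block-responsive decision trees. A node carries its state `(t, k, A)`, an internal node also
its block, a left subtree (all offers rejected) and a right subtree (an offer accepted). -/
inductive BlockTree (n : ℕ) : Type
  | leaf (t k : ℕ) (A : Finset (Fin n)) : BlockTree n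
  | node (t k : ℕ) (A : Finset (Fin n)) (B : List (Fin n)) (left right : BlockTree n) :
      BlockTree n

/-- The number of nodes, leaves included. -/
def BlockTree.numNodes {n : ℕ} : BlockTree n → ℕ
  | .leaf _ _ _ => 1
  | .node _ _ _ _ l r => 1 + l.numNodes + r.numNodes

/-- The maximum number of arcs on a root-to-leaf path. -/
def BlockTree.depth {n : ℕ} : BlockTree n → ℕ
  | .leaf _ _ _ => 0
  | .node _ _ _ _ l r => 1 + max l.depth r.depth

/-- The decision tree of a block-responsive policy started at the state `(t, k, A)`. -/
def BlockPolicy.treeFrom {n T : ℕ} (H : BlockPolicy n T) (t k : ℕ) (A : Finset (Fin n)) :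
    BlockTree n :=
  if _h : NonTerminal T t k A ∧ H.block t k A ≠ [] then
    .node t k A (H.block t k A)
      (H.treeFrom (t + (H.block t k A).length) k (A \ (H.block t k A).toFinset))
      (H.treeFrom (t + (H.block t k A).length) (k - 1) (A \ (H.block t k A).toFinset))
  else .leaf t k A
termination_by T + 1 - t
decreasing_by
  all_goals
    have _h1 := _h.1.1
    have h2 := List.length_pos_iff.mpr _h.2
    omega

/-- The decision tree of a block-responsive policy, started at `(1, k, [n])`. -/
def BlockPolicy.decisionTree {n : ℕ} (I : HiringInstance n) (H : BlockPolicy n I.horizon) :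
    BlockTree n :=
  H.treeFrom 1 I.positions Finset.univ

/-- The block-order-by-value rule for applicants with values `v` that are partitioned into
classes `C_m = {i | cls i = m}`: at every state, the `C_m`-applicants of the block form a prefix
of the available `C_m`-applicants, listed by decreasing value with ties broken by index. -/
def BlockPolicy.BlockOrderByValue {n T : ℕ} (H : BlockPolicy n T) (cls : Fin n → ℕ)
    (v : Fin n → ℝ) : Prop :=
  ∀ t k A, NonTerminal T t k A → ∀ m : ℕ, ∀ i ∈ A, cls i = m → ∀ j ∈ H.block t k A, cls j = m →
    (v j < v i ∨ (v i = v j ∧ i < j)) → i ∈ H.block t k A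

/-! ### Acceptance-probability classes and the mixed-rounded instance -/

namespace HiringInstance

variable {n : ℕ}

/-- The threshold `γ = ε / T`. -/
noncomputable def gamma (I : HiringInstance n) (ε : ℝ) : ℝ := ε / I.horizon

/-- The index `m` of the class `C_m` of applicant `i`: `C_0` is given by `p_i ≤ γ`, and `C_m`
for `m ≥ 1` by `(1 + ε)^(m-1) γ < p_i ≤ (1 + ε)^m γ`; see `classIndex_eq_zero_iff` and
`classIndex_eq_succ_iff`. -/
noncomputable def classIndex (I : HiringInstance n) (ε : ℝ) (i : Fin n) : ℕ :=
  sInf {m : ℕ | I.prob i ≤ (1 + ε) ^ m * I.gamma ε}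

/-- The rounded-up probability: `γ` on `C_0`, unchanged elsewhere. -/
noncomputable def probUp (I : HiringInstance n) (ε : ℝ) (i : Fin n) : ℝ :=
  if I.classIndex ε i = 0 then I.gamma ε else I.prob i

/-- The modified value `v_i p_i / p_i^↑`. -/
noncomputable def valueUp (I : HiringInstance n) (ε : ℝ) (i : Fin n) : ℝ :=
  I.value i * I.prob i / I.probUp ε i

/-- The mixed-rounded probability: `γ` on `C_0` and `(1 + ε)^(m-1) γ` on `C_m`, `m ≥ 1`. -/
noncomputable def probMixed (I : HiringInstance n) (ε : ℝ) (i : Fin n) : ℝ :=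
  if I.classIndex ε i = 0 then I.probUp ε i
  else (1 + ε) ^ (I.classIndex ε i - 1) * I.gamma ε

/-- The mixed-rounded instance. -/
noncomputable def mixedRounded (I : HiringInstance n) (ε : ℝ) : HiringInstance n where
  value := I.valueUp ε
  prob := I.probMixed ε
  positions := I.positions
  horizon := I.horizon

theorem classIndex_nonempty (I : HiringInstance n) {ε : ℝ} (hε : 0 < ε) (hT : 1 ≤ I.horizon)
    (i : Fin n) : {m : ℕ | I.prob i ≤ (1 + ε) ^ m * I.gamma ε}.Nonempty := by
  have hγ : 0 < I.gamma ε := div_pos hε (by exact_mod_cast hT)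
  obtain ⟨m, hm⟩ := pow_unbounded_of_one_lt (I.prob i / I.gamma ε) (by linarith : 1 < 1 + ε)
  exact ⟨m, ((div_lt_iff₀ hγ).mp hm).le⟩

theorem classIndex_eq_zero_iff (I : HiringInstance n) {ε : ℝ} (hε : 0 < ε) (hT : 1 ≤ I.horizon)
    (i : Fin n) : I.classIndex ε i = 0 ↔ I.prob i ≤ I.gamma ε := by
  rw [classIndex, Nat.sInf_eq_zero]
  simp [(I.classIndex_nonempty hε hT i).ne_empty]

theorem classIndex_eq_succ_iff (I : HiringInstance n) {ε : ℝ} (hε : 0 < ε) (hT : 1 ≤ I.horizon)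
    (i : Fin n) (m : ℕ) : I.classIndex ε i = m + 1 ↔
      (1 + ε) ^ m * I.gamma ε < I.prob i ∧ I.prob i ≤ (1 + ε) ^ (m + 1) * I.gamma ε := by
  have hγ : 0 < I.gamma ε := div_pos hε (by exact_mod_cast hT)
  rw [classIndex, Nat.sInf_upward_closed_eq_succ_iff]
  · simp only [Set.mem_ofPred_eq, not_le]
    exact and_comm
  · intro a b hab ha
    refine le_trans (Set.mem_ofPred_eq ▸ ha) ?_
    have : (1 : ℝ) ≤ 1 + ε := by linarith
    gcongr

end HiringInstance

end SeqHiring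

/-!
Let `V` be the optimal value of the mixed-rounded instance, let `δ = ε ^ 3 * V`, and let
`optValue p v r k A` be the optimal value of a state with `r` stages left.

Applicants of one class have equal acceptance probabilities. By an exchange argument
(`optValue_insert_le`, `offerValue_le_offerValue`) some optimal offer therefore always goes to the
most valuable available applicant of its class; fix such an optimal choice `pick` at every state
(`exists_optimal_offer`).

From a state with `k` open positions follow `pick` as long as all offers are rejected. The optimal
value of the state entered *when the current offer is accepted* (`acceptValue`) is nonincreasing
along this path. The block of the policy is the longest initial part of the path on which this
value stays within `δ` of its first value. The rule on the order within a class is then automatic.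

* Reward. Rejecting a whole block loses nothing against the optimum. If an applicant in the block
  accepts, the policy moves to the end of the block instead of the next stage, which costs at most
  `δ` by the choice of the block. At most `k` acceptances occur, so the policy earns at least
  `V - k * δ = (1 - ε ^ 3 * k) * V` (`optValue_sub_le_expectation`).
* Size. From one block to the next along rejections, `acceptValue` drops by more than `δ`. As it
  lies between `0` and `V = δ / ε ^ 3`, at most `L = ⌊1 / ε ^ 3⌋ + 1` blocks are offered between
  two acceptances. Hence the decision tree has depth at most `k * L` and at most `(2 * L + 1) ^ k`
  nodes (`nearConstantPolicy_tree_bound`).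

The bounds in terms of `1 / ε` hold because `4 * ε ^ 3 * k < 1` keeps `ε` away from `1`; in the
other case, or if `V = 0`, the policy that makes no offers suffices.
-/

namespace SeqHiring

open Finset Function

variable {n : ℕ}

/-! ### Independent acceptances -/

/-- The expectation as a sum over the decisions `η` of the applicants other than `i`. -/
theorem expectation_eq_sum_split (p : Fin n → ℝ) (i : Fin n) (f : (Fin n → Bool) → ℝ) :
    expectation p f = ∑ η : {j // j ≠ i} → Bool,
      (∏ j : {j // j ≠ i}, if η j then p j else 1 - p j) *
        (p i * f ((Equiv.funSplitAt i Bool).symm (true, η)) +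
          (1 - p i) * f ((Equiv.funSplitAt i Bool).symm (false, η))) := by
  unfold expectation
  rw [← Equiv.sum_comp (Equiv.funSplitAt i Bool).symm, Fintype.sum_prod_type_right]
  refine Finset.sum_congr rfl fun η _ => ?_
  have key : ∀ x : Bool, (∏ j, if (Equiv.funSplitAt i Bool).symm (x, η) j then p j else 1 - p j)
      = (if x then p i else 1 - p i) * ∏ j : {j // j ≠ i}, if η j then p j else 1 - p j := by
    intro x
    rw [Fintype.prod_eq_mul_prod_subtype_ne _ i]
    congr 1
    · simp [Equiv.funSplitAt]
    · refine Finset.prod_congr rfl fun j _ => ?_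
      simp [Equiv.funSplitAt, j.2]
  simp only [Fintype.sum_bool, key]
  simp
  ring

/-- Conditioning on the decision of applicant `i`. -/
theorem expectation_eq_update (p : Fin n → ℝ) (i : Fin n) (f : (Fin n → Bool) → ℝ) :
    expectation p f = p i * expectation p (fun ω => f (update ω i true)) +
      (1 - p i) * expectation p (fun ω => f (update ω i false)) := by
  have hu : ∀ (x y : Bool) (η : {j // j ≠ i} → Bool),
      update ((Equiv.funSplitAt i Bool).symm (x, η)) i y
        = (Equiv.funSplitAt i Bool).symm (y, η) := by
    intro x y η
    ext j
    by_cases h : j = i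
    · subst h; simp [Equiv.funSplitAt]
    · simp [Equiv.funSplitAt, h]
  simp only [expectation_eq_sum_split p i, hu, Finset.mul_sum, ← Finset.sum_add_distrib]
  refine Finset.sum_congr rfl fun η _ => ?_
  ring

theorem expectation_const_add (p : Fin n → ℝ) (c : ℝ) (f : (Fin n → Bool) → ℝ) :
    expectation p (fun ω => c + f ω) = c + expectation p f := by
  have h1 : ∑ ω : Fin n → Bool, ∏ i, (if ω i then p i else 1 - p i) = 1 := by
    have h := Finset.prod_univ_sum (fun _ : Fin n => (Finset.univ : Finset Bool))
      (fun i x => if x then p i else 1 - p i)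
    rw [Fintype.piFinset_univ] at h
    rw [← h]
    simp
  simp only [expectation, mul_add, Finset.sum_add_distrib, ← Finset.sum_mul, h1, one_mul]

theorem expectation_nonneg {p : Fin n → ℝ} (hp0 : ∀ i, 0 ≤ p i) (hp1 : ∀ i, p i ≤ 1)
    {f : (Fin n → Bool) → ℝ} (hf : ∀ ω, 0 ≤ f ω) : 0 ≤ expectation p f := by
  refine Finset.sum_nonneg fun ω _ => mul_nonneg (Finset.prod_nonneg fun i _ => ?_) (hf ω)
  split_ifs
  · exact hp0 i
  · linarith [hp1 i]

/-! ### The optimal value of a state -/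

/-- The largest expected reward obtainable with `r` stages left, `k` open positions and available
applicants `A`, by backward induction on `r`. -/
noncomputable def optValue (p v : Fin n → ℝ) : ℕ → ℕ → Finset (Fin n) → ℝ
  | 0, _, _ => 0
  | _ + 1, 0, _ => 0
  | r + 1, k + 1, A =>
    if h : A.Nonempty then
      A.sup' h fun i => p i * (v i + optValue p v r k (A.erase i)) +
        (1 - p i) * optValue p v r (k + 1) (A.erase i)
    else 0

/-- The expected reward of offering to `i` and continuing optimally, with `r + 1` stages left and
`k + 1` open positions. -/
noncomputable def offerValue (p v : Fin n → ℝ) (r k : ℕ) (A : Finset (Fin n)) (i : Fin n) : ℝ :=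
  p i * (v i + optValue p v r k (A.erase i)) + (1 - p i) * optValue p v r (k + 1) (A.erase i)

theorem optValue_succ {p v : Fin n → ℝ} {r k : ℕ} {A : Finset (Fin n)} (h : A.Nonempty) :
    optValue p v (r + 1) (k + 1) A = A.sup' h (offerValue p v r k A) := by
  rw [optValue, dif_pos h]; rfl

@[simp]
theorem optValue_zero_left (p v : Fin n → ℝ) (k : ℕ) (A : Finset (Fin n)) :
    optValue p v 0 k A = 0 := by
  rw [optValue]

@[simp]
theorem optValue_zero_right (p v : Fin n → ℝ) (r : ℕ) (A : Finset (Fin n)) :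
    optValue p v r 0 A = 0 := by
  cases r <;> rw [optValue]

@[simp]
theorem optValue_empty (p v : Fin n → ℝ) (r k : ℕ) : optValue p v r k ∅ = 0 := by
  cases r <;> cases k <;> simp [optValue]

theorem offerValue_le {p v : Fin n → ℝ} {r k : ℕ} {A : Finset (Fin n)} {i : Fin n} (h : i ∈ A) :
    offerValue p v r k A i ≤ optValue p v (r + 1) (k + 1) A := by
  rw [optValue_succ ⟨i, h⟩]
  exact Finset.le_sup' _ h

theorem optValue_nonneg {p v : Fin n → ℝ} (hp0 : ∀ i, 0 ≤ p i) (hp1 : ∀ i, p i ≤ 1)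
    (hv : ∀ i, 0 ≤ v i) (r k : ℕ) (A : Finset (Fin n)) : 0 ≤ optValue p v r k A := by
  induction r generalizing k A with
  | zero => simp
  | succ r ih =>
    rcases k with _ | k
    · simp
    rcases A.eq_empty_or_nonempty with rfl | ⟨i, hi⟩
    · simp
    refine le_trans ?_ (offerValue_le hi)
    exact add_nonneg (mul_nonneg (hp0 i) (add_nonneg (hv i) (ih _ _)))
      (mul_nonneg (sub_nonneg.2 (hp1 i)) (ih _ _))

theorem optValue_mono {p v : Fin n → ℝ} (hp0 : ∀ i, 0 ≤ p i) (hp1 : ∀ i, p i ≤ 1)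
    (hv : ∀ i, 0 ≤ v i) {r r' k k' : ℕ} {A A' : Finset (Fin n)} (hr : r ≤ r') (hk : k ≤ k')
    (hA : A ⊆ A') : optValue p v r k A ≤ optValue p v r' k' A' := by
  induction r generalizing r' k k' A A' with
  | zero => simpa using optValue_nonneg hp0 hp1 hv r' k' A'
  | succ r ih =>
    obtain ⟨r', rfl⟩ : ∃ s, r' = s + 1 := ⟨r' - 1, by omega⟩
    rcases k with _ | k
    · simpa using optValue_nonneg hp0 hp1 hv _ _ _
    obtain ⟨k', rfl⟩ : ∃ s, k' = s + 1 := ⟨k' - 1, by omega⟩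
    rcases A.eq_empty_or_nonempty with rfl | h
    · simpa using optValue_nonneg hp0 hp1 hv _ _ _
    rw [optValue_succ h]
    refine Finset.sup'_le _ _ fun i hi => le_trans ?_ (offerValue_le (hA hi))
    have h1 := ih (r' := r') (k := k) (k' := k') (by omega) (by omega)
      (Finset.erase_subset_erase i hA)
    have h2 := ih (r' := r') (by omega) hk (Finset.erase_subset_erase i hA)
    have h3 : 0 ≤ 1 - p i := sub_nonneg.2 (hp1 i)
    have h4 := hp0 i
    unfold offerValue
    gcongr

/-- Replacing an available applicant `i` by a better applicant `j` of equal acceptance probability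
gains at most `p (v_j - v_i)`: a policy that uses `j` can be imitated with `i` in its place, and
`j` gets at most one offer. -/
theorem optValue_insert_le {p v : Fin n → ℝ} (hp0 : ∀ i, 0 ≤ p i) (hp1 : ∀ i, p i ≤ 1)
    {i j : Fin n} (hp : p i = p j) (hv : v i ≤ v j) (r k : ℕ) {A : Finset (Fin n)}
    (hi : i ∉ A) (hj : j ∉ A) :
    optValue p v r k (insert j A) ≤ optValue p v r k (insert i A) + p j * (v j - v i) := by
  have hΔ : 0 ≤ p j * (v j - v i) := mul_nonneg (hp0 j) (sub_nonneg.2 hv)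
  induction r generalizing k A with
  | zero => simpa using hΔ
  | succ r ih =>
    rcases k with _ | k
    · simpa using hΔ
    rw [optValue_succ (Finset.insert_nonempty j A)]
    refine Finset.sup'_le _ _ fun b hb => ?_
    rcases Finset.mem_insert.1 hb with rfl | hbA
    -- After an offer to `j` and to `i`, respectively, the same applicants `A` remain.
    · have h := offerValue_le (p := p) (v := v) (r := r) (k := k) (Finset.mem_insert_self i A)
      unfold offerValue at h ⊢
      rw [Finset.erase_insert hi, hp] at h
      rw [Finset.erase_insert hj]
      linarith
    · have h := offerValue_le (p := p) (v := v) (r := r) (k := k)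
        (Finset.mem_insert_of_mem (a := b) (b := i) hbA)
      have hbi : b ≠ i := fun e => hi (e ▸ hbA)
      have hbj : b ≠ j := fun e => hj (e ▸ hbA)
      have hi' : i ∉ A.erase b := fun e => hi (Finset.mem_of_mem_erase e)
      have hj' : j ∉ A.erase b := fun e => hj (Finset.mem_of_mem_erase e)
      unfold offerValue at h ⊢
      rw [Finset.erase_insert_of_ne hbi.symm] at h
      rw [Finset.erase_insert_of_ne hbj.symm]
      have h1 := mul_le_mul_of_nonneg_left (ih k hi' hj') (hp0 b)
      have h2 := mul_le_mul_of_nonneg_left (ih (k + 1) hi' hj') (sub_nonneg.2 (hp1 b))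
      linarith

/-- Among applicants of equal acceptance probability, offering to the most valuable one first is
best. -/
theorem offerValue_le_offerValue {p v : Fin n → ℝ} (hp0 : ∀ i, 0 ≤ p i) (hp1 : ∀ i, p i ≤ 1)
    {i j : Fin n} (hp : p i = p j) (hv : v i ≤ v j) (r k : ℕ) {A : Finset (Fin n)}
    (hi : i ∈ A) (hj : j ∈ A) : offerValue p v r k A i ≤ offerValue p v r k A j := by
  rcases eq_or_ne i j with rfl | hij
  · exact le_rfl
  have ei : A.erase i = insert j ((A.erase i).erase j) :=
    (Finset.insert_erase (Finset.mem_erase.2 ⟨hij.symm, hj⟩)).symm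
  have ej : A.erase j = insert i ((A.erase i).erase j) := by
    rw [Finset.erase_right_comm, Finset.insert_erase (Finset.mem_erase.2 ⟨hij, hi⟩)]
  have hi' : i ∉ (A.erase i).erase j := by simp
  have hj' : j ∉ (A.erase i).erase j := by simp
  have h1 := mul_le_mul_of_nonneg_left
    (optValue_insert_le hp0 hp1 hp hv r k hi' hj') (hp0 j)
  have h2 := mul_le_mul_of_nonneg_left
    (optValue_insert_le hp0 hp1 hp hv r (k + 1) hi' hj') (sub_nonneg.2 (hp1 j))
  unfold offerValue
  rw [ei, ej, hp]
  linarith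

/-- Some optimal offer goes to the first available applicant of its class, in the order of
decreasing value with ties broken by index. -/
theorem exists_optimal_offer {p v : Fin n → ℝ} (hp0 : ∀ i, 0 ≤ p i) (hp1 : ∀ i, p i ≤ 1)
    {cls : Fin n → ℕ} (hcls : ∀ i j, cls i = cls j → p i = p j) (r k : ℕ) {A : Finset (Fin n)}
    (hA : A.Nonempty) :
    ∃ b ∈ A, offerValue p v r k A b = optValue p v (r + 1) (k + 1) A ∧
      ∀ i ∈ A, cls i = cls b → ¬ (v b < v i ∨ (v i = v b ∧ i < b)) := by
  obtain ⟨i, hi, hmax⟩ := Finset.exists_mem_eq_sup' hA (offerValue p v r k A)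
  -- In the lexicographic order, a smaller index is better and hence larger in the order dual.
  obtain ⟨b, hb, hbest⟩ := Finset.exists_max_image {j ∈ A | cls j = cls i}
    (fun j => toLex (v j, OrderDual.toDual j)) ⟨i, by simp [hi]⟩
  simp only [Finset.mem_filter, and_imp] at hb hbest
  refine ⟨b, hb.1, le_antisymm (offerValue_le hb.1) ?_, fun j hj hjb hlt => ?_⟩
  · rw [optValue_succ hA, hmax]
    refine offerValue_le_offerValue hp0 hp1 (hcls _ _ hb.2.symm) ?_ r k hi hb.1
    rcases Prod.Lex.toLex_le_toLex.1 (hbest i hi rfl) with h | h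
    · exact h.le
    · exact h.1.le
  · refine absurd (hbest j hj (hjb.trans hb.2)) (not_le.2 ?_)
    rw [Prod.Lex.toLex_lt_toLex]
    rcases hlt with h | ⟨h, h'⟩
    · exact Or.inl h
    · exact Or.inr ⟨h.symm, h'⟩

/-! ### Hiring policies -/

theorem HiringPolicy.sampleReward_of_not_nonTerminal (H : HiringPolicy n) (v : Fin n → ℝ) {T : ℕ}
    (ω : Fin n → Bool) {t k : ℕ} {A : Finset (Fin n)} (hN : ¬ NonTerminal T t k A) :
    H.sampleReward v T ω t k A = 0 := by
  rw [sampleReward, dif_neg hN]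

/-- The reward collected from a state on depends only on the decisions of the applicants still
available. -/
theorem HiringPolicy.sampleReward_congr (H : HiringPolicy n) (v : Fin n → ℝ) (T : ℕ)
    {ω ω' : Fin n → Bool} (t k : ℕ) (A : Finset (Fin n)) (h : ∀ i ∈ A, ω i = ω' i) :
    H.sampleReward v T ω t k A = H.sampleReward v T ω' t k A := by
  induction hr : T + 1 - t generalizing t k A with
  | zero =>
    have hn : ¬ NonTerminal T t k A := fun hN => by have := hN.1; omega
    rw [H.sampleReward_of_not_nonTerminal v _ hn, H.sampleReward_of_not_nonTerminal v _ hn]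
  | succ r ih =>
    rw [sampleReward, sampleReward]
    by_cases hN : NonTerminal T t k A
    · have hb := (H t k A hN.2.2).2
      rw [dif_pos hN, dif_pos hN, h _ hb,
        ih _ _ _ (fun i hi => h i (Finset.mem_of_mem_erase hi)) (by omega),
        ih _ _ _ (fun i hi => h i (Finset.mem_of_mem_erase hi)) (by omega)]
    · rw [dif_neg hN, dif_neg hN]

theorem HiringPolicy.sampleReward_nonneg (H : HiringPolicy n) {v : Fin n → ℝ} (hv : ∀ i, 0 ≤ v i)
    (T : ℕ) (ω : Fin n → Bool) (t k : ℕ) (A : Finset (Fin n)) :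
    0 ≤ H.sampleReward v T ω t k A := by
  induction hr : T + 1 - t generalizing t k A with
  | zero =>
    have hn : ¬ NonTerminal T t k A := fun hN => by have := hN.1; omega
    rw [H.sampleReward_of_not_nonTerminal v _ hn]
  | succ r ih =>
    rw [sampleReward]
    split_ifs
    · exact add_nonneg (hv _) (ih _ _ _ (by omega))
    · exact ih _ _ _ (by omega)
    · exact le_rfl

theorem HiringPolicy.expectation_sampleReward_le {p v : Fin n → ℝ} (hp0 : ∀ i, 0 ≤ p i)
    (hp1 : ∀ i, p i ≤ 1) (H : HiringPolicy n) (T t k : ℕ) (A : Finset (Fin n)) :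
    expectation p (fun ω => H.sampleReward v T ω t k A) ≤ optValue p v (T + 1 - t) k A := by
  induction hr : T + 1 - t generalizing t k A with
  | zero =>
    have hn : ¬ NonTerminal T t k A := fun hN => by have := hN.1; omega
    simp only [H.sampleReward_of_not_nonTerminal v _ hn]
    simp [expectation]
  | succ r ih =>
    by_cases hN : NonTerminal T t k A
    · obtain ⟨k, rfl⟩ : ∃ s, k = s + 1 := ⟨k - 1, by have := hN.2.1; omega⟩
      obtain ⟨b, hb⟩ : ∃ b, H t (k + 1) A hN.2.2 = b := ⟨_, rfl⟩
      have hupd : ∀ (ω : Fin n → Bool) (x : Bool) (l : ℕ),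
          H.sampleReward v T (update ω b x) (t + 1) l (A.erase b) =
            H.sampleReward v T ω (t + 1) l (A.erase b) := fun ω x l =>
        H.sampleReward_congr v T _ _ _ fun i hi =>
          update_of_ne (Finset.ne_of_mem_erase hi) _ _
      have hsplit : expectation p (fun ω => H.sampleReward v T ω t (k + 1) A) =
          p b * (v b + expectation p fun ω => H.sampleReward v T ω (t + 1) k (A.erase b)) +
            (1 - p b) *
              expectation p fun ω => H.sampleReward v T ω (t + 1) (k + 1) (A.erase b) := by
        rw [expectation_eq_update p b, ← expectation_const_add]
        congr 3 <;> funext ω <;> rw [sampleReward, dif_pos hN, hb] <;>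
          simp [hupd]
      have h3 : 0 ≤ 1 - p b := sub_nonneg.2 (hp1 b)
      have h4 := hp0 b
      have h1 := ih (t + 1) k (A.erase b) (by omega)
      have h2 := ih (t + 1) (k + 1) (A.erase b) (by omega)
      rw [hsplit]
      refine le_trans ?_ (offerValue_le b.2)
      unfold offerValue
      gcongr
    · simp only [H.sampleReward_of_not_nonTerminal v _ hN]
      have : optValue p v (r + 1) k A = 0 := by
        rcases k with _ | k
        · simp
        rcases A.eq_empty_or_nonempty with rfl | h
        · simp
        · exact absurd ⟨by omega, by omega, h⟩ hN
      rw [this]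
      simp [expectation]

/-! ### Block-responsive policies -/

theorem BlockPolicy.sampleReward_of_leaf {T : ℕ} (H : BlockPolicy n T) (v : Fin n → ℝ)
    (ω : Fin n → Bool) {t k : ℕ} {A : Finset (Fin n)}
    (h : ¬ (NonTerminal T t k A ∧ H.block t k A ≠ [])) : H.sampleReward v ω t k A = 0 := by
  rw [sampleReward, dif_neg h]

theorem BlockPolicy.sampleReward_of_internal {T : ℕ} (H : BlockPolicy n T) (v : Fin n → ℝ)
    (ω : Fin n → Bool) {t k : ℕ} {A : Finset (Fin n)}
    (h : NonTerminal T t k A ∧ H.block t k A ≠ []) :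
    H.sampleReward v ω t k A =
      match (H.block t k A).find? (fun i => ω i) with
      | some i => v i + H.sampleReward v ω (t + (H.block t k A).length) (k - 1)
          (A \ (H.block t k A).toFinset)
      | none => H.sampleReward v ω (t + (H.block t k A).length) k
          (A \ (H.block t k A).toFinset) := by
  rw [sampleReward, dif_pos h]

/-- The reward collected from a state on depends only on the decisions of the applicants still
available. -/
theorem BlockPolicy.sampleReward_congr {T : ℕ} (H : BlockPolicy n T) (v : Fin n → ℝ)
    {ω ω' : Fin n → Bool} (t k : ℕ) (A : Finset (Fin n)) (h : ∀ i ∈ A, ω i = ω' i) :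
    H.sampleReward v ω t k A = H.sampleReward v ω' t k A := by
  induction hr : T + 1 - t using Nat.strong_induction_on generalizing t k A with
  | _ r ih =>
    by_cases hN : NonTerminal T t k A ∧ H.block t k A ≠ []
    · have hlen := List.length_pos_iff.2 hN.2
      have hT := hN.1.1
      have hfind : (H.block t k A).find? (fun i => ω i) =
          (H.block t k A).find? (fun i => ω' i) := by
        rw [← List.head?_filter, ← List.head?_filter]
        congr 1
        exact List.filter_congr fun i hi => by rw [h i (H.available t k A hN.1 i hi)]
      have hsub : ∀ l, H.sampleReward v ω (t + (H.block t k A).length) l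
            (A \ (H.block t k A).toFinset) =
          H.sampleReward v ω' (t + (H.block t k A).length) l (A \ (H.block t k A).toFinset) :=
        fun l => ih _ (by omega) _ _ _ (fun i hi => h i (Finset.mem_sdiff.1 hi).1) rfl
      rw [H.sampleReward_of_internal v ω hN, H.sampleReward_of_internal v ω' hN, hfind]
      simp only [hsub]
    · rw [H.sampleReward_of_leaf v ω hN, H.sampleReward_of_leaf v ω' hN]

/-- The expected reward of making offers along a list up to the first acceptance, if the
continuation is worth `a` after an acceptance and `s` after rejections only. -/
def listValue (p v : Fin n → ℝ) (a s : ℝ) : List (Fin n) → ℝ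
  | [] => s
  | b :: l => p b * (v b + a) + (1 - p b) * listValue p v a s l

/-- Offers along a list of distinct applicants, where the continuations `f` after an acceptance and
`g` after rejections only are independent of the applicants in the list. -/
theorem expectation_find (p v : Fin n → ℝ) {f g : (Fin n → Bool) → ℝ} {l : List (Fin n)}
    (hl : l.Nodup) (hf : ∀ b ∈ l, ∀ ω x, f (update ω b x) = f ω)
    (hg : ∀ b ∈ l, ∀ ω x, g (update ω b x) = g ω) :
    expectation p (fun ω => match l.find? (fun i => ω i) with
      | some i => v i + f ω
      | none => g ω) = listValue p v (expectation p f) (expectation p g) l := by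
  induction l with
  | nil => simp [listValue]
  | cons b l ih =>
    obtain ⟨hb, hl⟩ := List.nodup_cons.1 hl
    rw [listValue, ← ih hl (fun c hc => hf c (List.mem_cons_of_mem _ hc))
      (fun c hc => hg c (List.mem_cons_of_mem _ hc)), expectation_eq_update p b,
      ← expectation_const_add]
    have hfind : ∀ ω : Fin n → Bool, l.find? (fun i => update ω b false i) =
        l.find? (fun i => ω i) := by
      intro ω
      rw [← List.head?_filter, ← List.head?_filter]
      congr 1
      exact List.filter_congr fun i hi => by
        rw [update_of_ne]
        rintro rfl
        exact hb hi
    have hfb := hf b (List.mem_cons_self ..)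
    have hgb := hg b (List.mem_cons_self ..)
    congr 3 <;> funext ω
    · simp [hfb]
    · simp [hfb, hgb, hfind]

theorem BlockPolicy.expectation_sampleReward {p v : Fin n → ℝ} {T : ℕ} (H : BlockPolicy n T)
    {t k : ℕ} {A : Finset (Fin n)} (hN : NonTerminal T t k A) (hB : H.block t k A ≠ []) :
    expectation p (fun ω => H.sampleReward v ω t k A) =
      listValue p v
        (expectation p fun ω => H.sampleReward v ω (t + (H.block t k A).length) (k - 1)
          (A \ (H.block t k A).toFinset))
        (expectation p fun ω => H.sampleReward v ω (t + (H.block t k A).length) k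
          (A \ (H.block t k A).toFinset)) (H.block t k A) := by
  have hupd : ∀ (l : ℕ), ∀ b ∈ H.block t k A, ∀ (ω : Fin n → Bool) (x : Bool),
      H.sampleReward v (update ω b x) (t + (H.block t k A).length) l
          (A \ (H.block t k A).toFinset) =
        H.sampleReward v ω (t + (H.block t k A).length) l (A \ (H.block t k A).toFinset) :=
    fun l b hb ω x => H.sampleReward_congr v _ _ _ fun i hi => update_of_ne (by
      rintro rfl
      exact (Finset.mem_sdiff.1 hi).2 (List.mem_toFinset.2 hb)) _ _
  rw [← expectation_find p v (H.nodup t k A hN) (hupd (k - 1)) (hupd k)]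
  congr 1
  funext ω
  exact H.sampleReward_of_internal v ω ⟨hN, hB⟩

/-! ### Blocks of nearly equal value after an acceptance -/

/-- The optimal value, with `r` stages left and `k + 1` open positions, after the applicant chosen
by `pick` accepts. The arguments `r` and `k` of `pick` stand for `r + 1` stages and `k + 1`
positions. The value is `0` if no offer is possible. -/
noncomputable def acceptValue (p v : Fin n → ℝ)
    (pick : ℕ → ℕ → (A : Finset (Fin n)) → A.Nonempty → Fin n) : ℕ → ℕ → Finset (Fin n) → ℝ
  | 0, _, _ => 0
  | r + 1, k, A => if h : A.Nonempty then optValue p v r k (A.erase (pick r k A h)) else 0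

/-- The initial part of the all-reject path of `pick`, with `r` stages left and `k + 1` open
positions, on which the value after an acceptance is at least `θ`. -/
noncomputable def thresholdBlock (p v : Fin n → ℝ)
    (pick : ℕ → ℕ → (A : Finset (Fin n)) → A.Nonempty → Fin n) (θ : ℝ) :
    ℕ → ℕ → Finset (Fin n) → List (Fin n)
  | 0, _, _ => []
  | r + 1, k, A =>
    open Classical in
    if h : A.Nonempty then
      if θ ≤ optValue p v r k (A.erase (pick r k A h)) then
        pick r k A h :: thresholdBlock p v pick θ r k (A.erase (pick r k A h))
      else []
    else []

/-- `pick` makes optimal offers, each to the first available applicant of its class in the order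
of decreasing value with ties broken by index. -/
def IsOptimalPick (p v : Fin n → ℝ) (cls : Fin n → ℕ)
    (pick : ℕ → ℕ → (A : Finset (Fin n)) → A.Nonempty → Fin n) : Prop :=
  ∀ r k A (h : A.Nonempty), pick r k A h ∈ A ∧
    offerValue p v r k A (pick r k A h) = optValue p v (r + 1) (k + 1) A ∧
    ∀ i ∈ A, cls i = cls (pick r k A h) →
      ¬ (v (pick r k A h) < v i ∨ (v i = v (pick r k A h) ∧ i < pick r k A h))

theorem exists_isOptimalPick {p : Fin n → ℝ} (v : Fin n → ℝ) (hp0 : ∀ i, 0 ≤ p i)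
    (hp1 : ∀ i, p i ≤ 1) {cls : Fin n → ℕ} (hcls : ∀ i j, cls i = cls j → p i = p j) :
    ∃ pick, IsOptimalPick p v cls pick := by
  choose pick hpick using fun (r k : ℕ) (A : Finset (Fin n)) (h : A.Nonempty) =>
    exists_optimal_offer (v := v) hp0 hp1 hcls r k h
  exact ⟨pick, hpick⟩

section ThresholdBlock

variable {p v : Fin n → ℝ} {cls : Fin n → ℕ}
  {pick : ℕ → ℕ → (A : Finset (Fin n)) → A.Nonempty → Fin n}

theorem acceptValue_succ {r k : ℕ} {A : Finset (Fin n)} (h : A.Nonempty) :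
    acceptValue p v pick (r + 1) k A = optValue p v r k (A.erase (pick r k A h)) := by
  rw [acceptValue, dif_pos h]

theorem acceptValue_nonneg (hp0 : ∀ i, 0 ≤ p i) (hp1 : ∀ i, p i ≤ 1)
    (hv : ∀ i, 0 ≤ v i) (r k : ℕ) (A : Finset (Fin n)) : 0 ≤ acceptValue p v pick r k A := by
  unfold acceptValue
  split
  · exact le_rfl
  · split_ifs
    · exact optValue_nonneg hp0 hp1 hv _ _ _
    · exact le_rfl

theorem acceptValue_le (hp0 : ∀ i, 0 ≤ p i) (hp1 : ∀ i, p i ≤ 1)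
    (hv : ∀ i, 0 ≤ v i) (r k : ℕ) (A : Finset (Fin n)) :
    acceptValue p v pick r k A ≤ optValue p v r k A := by
  unfold acceptValue
  split
  · simp
  · split_ifs
    · exact optValue_mono hp0 hp1 hv (Nat.le_succ _) le_rfl (Finset.erase_subset _ _)
    · exact optValue_nonneg hp0 hp1 hv _ _ _

@[simp]
theorem thresholdBlock_zero (θ : ℝ) (k : ℕ) (A : Finset (Fin n)) :
    thresholdBlock p v pick θ 0 k A = [] := by
  rw [thresholdBlock]

@[simp]
theorem thresholdBlock_empty (θ : ℝ) (r k : ℕ) : thresholdBlock p v pick θ r k ∅ = [] := by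
  cases r <;> simp [thresholdBlock]

theorem thresholdBlock_of_lt {θ : ℝ} {r k : ℕ} {A : Finset (Fin n)}
    (h : acceptValue p v pick r k A < θ) : thresholdBlock p v pick θ r k A = [] := by
  rcases r with _ | r
  · simp
  rcases A.eq_empty_or_nonempty with rfl | hA
  · simp
  rw [acceptValue_succ hA] at h
  rw [thresholdBlock, dif_pos hA, if_neg h.not_ge]

theorem thresholdBlock_of_le {θ : ℝ} {r k : ℕ} {A : Finset (Fin n)} (hA : A.Nonempty)
    (h : θ ≤ acceptValue p v pick (r + 1) k A) :
    thresholdBlock p v pick θ (r + 1) k A =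
      pick r k A hA :: thresholdBlock p v pick θ r k (A.erase (pick r k A hA)) := by
  rw [acceptValue_succ hA] at h
  rw [thresholdBlock, dif_pos hA, if_pos h]

/-- Induction along the all-reject path that makes up a block. -/
theorem thresholdBlock_induction {θ : ℝ} {k : ℕ}
    {motive : ℕ → Finset (Fin n) → List (Fin n) → Prop}
    (nil : ∀ r A, (0 < r → A.Nonempty → acceptValue p v pick r k A < θ) → motive r A [])
    (cons : ∀ r A (hA : A.Nonempty), θ ≤ acceptValue p v pick (r + 1) k A →
      motive r (A.erase (pick r k A hA))
        (thresholdBlock p v pick θ r k (A.erase (pick r k A hA))) →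
      motive (r + 1) A
        (pick r k A hA :: thresholdBlock p v pick θ r k (A.erase (pick r k A hA))))
    (r : ℕ) (A : Finset (Fin n)) : motive r A (thresholdBlock p v pick θ r k A) := by
  induction r generalizing A with
  | zero => simpa using nil 0 A (by simp)
  | succ r ih =>
    rcases A.eq_empty_or_nonempty with rfl | hA
    · simpa using nil (r + 1) ∅ (by simp)
    rcases lt_or_ge (acceptValue p v pick (r + 1) k A) θ with h | h
    · rw [thresholdBlock_of_lt h]
      exact nil _ _ fun _ _ => h
    · rw [thresholdBlock_of_le hA h]
      exact cons r A hA h (ih _)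

theorem sdiff_toFinset_cons (A : Finset (Fin n)) (b : Fin n) (l : List (Fin n)) :
    A \ (b :: l).toFinset = A.erase b \ l.toFinset := by
  ext i
  simp only [Finset.mem_sdiff, List.mem_toFinset, List.mem_cons, Finset.mem_erase]
  tauto

theorem thresholdBlock_subset (hpick : IsOptimalPick p v cls pick) (θ : ℝ) (r k : ℕ)
    (A : Finset (Fin n)) : ∀ i ∈ thresholdBlock p v pick θ r k A, i ∈ A := by
  refine thresholdBlock_induction (motive := fun _ A l => ∀ i ∈ l, i ∈ A) (by simp) ?_ r A
  intro r A hA _ ih i hi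
  rcases List.mem_cons.1 hi with rfl | hi
  · exact (hpick r k A hA).1
  · exact Finset.mem_of_mem_erase (ih i hi)

theorem thresholdBlock_nodup (hpick : IsOptimalPick p v cls pick) (θ : ℝ) (r k : ℕ)
    (A : Finset (Fin n)) : (thresholdBlock p v pick θ r k A).Nodup := by
  refine thresholdBlock_induction (motive := fun _ _ l => l.Nodup) (by simp) ?_ r A
  intro r A hA _ ih
  refine List.nodup_cons.2 ⟨fun h => ?_, ih⟩
  exact Finset.notMem_erase _ _ (thresholdBlock_subset hpick θ r k _ _ h)

theorem thresholdBlock_length_le (θ : ℝ) (r k : ℕ) (A : Finset (Fin n)) :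
    (thresholdBlock p v pick θ r k A).length ≤ r := by
  refine thresholdBlock_induction (motive := fun r _ l => l.length ≤ r) (by simp) ?_ r A
  intro r A hA _ ih
  simpa using ih

theorem thresholdBlock_order (hpick : IsOptimalPick p v cls pick) (θ : ℝ) (r k : ℕ)
    (A : Finset (Fin n)) : ∀ i ∈ A, ∀ j ∈ thresholdBlock p v pick θ r k A, cls i = cls j →
      (v j < v i ∨ (v i = v j ∧ i < j)) → i ∈ thresholdBlock p v pick θ r k A := by
  refine thresholdBlock_induction (motive := fun _ A l => ∀ i ∈ A, ∀ j ∈ l, cls i = cls j →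
    (v j < v i ∨ (v i = v j ∧ i < j)) → i ∈ l) (by simp) ?_ r A
  intro r A hA _ ih i hi j hj hij hlt
  rcases eq_or_ne i (pick r k A hA) with rfl | hne
  · exact List.mem_cons_self ..
  rcases List.mem_cons.1 hj with rfl | hj
  · exact absurd hlt ((hpick r k A hA).2.2 i hi hij)
  · exact List.mem_cons_of_mem _ (ih i (Finset.mem_erase.2 ⟨hne, hi⟩) j hj hij hlt)

/-- Where a block ends, the path is over or the value after an acceptance is below `θ`. -/
theorem acceptValue_lt_of_thresholdBlock (θ : ℝ) (r k : ℕ) (A : Finset (Fin n)) :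
    0 < r - (thresholdBlock p v pick θ r k A).length →
    (A \ (thresholdBlock p v pick θ r k A).toFinset).Nonempty →
    acceptValue p v pick (r - (thresholdBlock p v pick θ r k A).length) k
      (A \ (thresholdBlock p v pick θ r k A).toFinset) < θ := by
  refine thresholdBlock_induction (motive := fun r A l => 0 < r - l.length →
    (A \ l.toFinset).Nonempty → acceptValue p v pick (r - l.length) k (A \ l.toFinset) < θ)
    (fun r A h => by simpa using h) ?_ r A
  intro r A hA _ ih
  rw [sdiff_toFinset_cons, List.length_cons, Nat.add_sub_add_right]
  exact ih

/-- The state reached from the end of a block by filling a position is still worth `θ`. -/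
theorem le_optValue_of_thresholdBlock (θ : ℝ) (r k : ℕ) (A : Finset (Fin n)) :
    thresholdBlock p v pick θ r k A ≠ [] →
    θ ≤ optValue p v (r - (thresholdBlock p v pick θ r k A).length) k
      (A \ (thresholdBlock p v pick θ r k A).toFinset) := by
  refine thresholdBlock_induction (motive := fun r A l => l ≠ [] →
    θ ≤ optValue p v (r - l.length) k (A \ l.toFinset)) (by simp) ?_ r A
  intro r A hA hθ ih _
  rw [sdiff_toFinset_cons, List.length_cons, Nat.add_sub_add_right]
  by_cases hl : thresholdBlock p v pick θ r k (A.erase (pick r k A hA)) = []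
  · rw [acceptValue_succ hA] at hθ
    simpa [hl] using hθ
  · exact ih hl

/-- If the continuations of a block fall short of optimal ones by at most `c`, then so does the
block. The value `u` bounds the optimal values after an acceptance inside the block. -/
theorem optValue_sub_le_listValue (hp0 : ∀ i, 0 ≤ p i) (hp1 : ∀ i, p i ≤ 1) (hv : ∀ i, 0 ≤ v i)
    (hpick : IsOptimalPick p v cls pick) {θ u a s c : ℝ} (ha : u - c ≤ a) (r k : ℕ)
    (A : Finset (Fin n)) : acceptValue p v pick r k A ≤ u →
    optValue p v (r - (thresholdBlock p v pick θ r k A).length) (k + 1)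
      (A \ (thresholdBlock p v pick θ r k A).toFinset) - c ≤ s →
    optValue p v r (k + 1) A - c ≤ listValue p v a s (thresholdBlock p v pick θ r k A) := by
  refine thresholdBlock_induction (motive := fun r A l => acceptValue p v pick r k A ≤ u →
    optValue p v (r - l.length) (k + 1) (A \ l.toFinset) - c ≤ s →
    optValue p v r (k + 1) A - c ≤ listValue p v a s l) ?_ ?_ r A
  · intro r A _ _ h
    simpa [listValue] using h
  · intro r A hA _ ih hu hs
    rw [sdiff_toFinset_cons, List.length_cons, Nat.add_sub_add_right] at hs
    rw [acceptValue_succ hA] at hu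
    have h1 := ih ((acceptValue_le hp0 hp1 hv _ _ _).trans hu) hs
    have h2 := mul_le_mul_of_nonneg_left h1 (sub_nonneg.2 (hp1 (pick r k A hA)))
    have h3 := mul_le_mul_of_nonneg_left ((sub_le_sub_right hu c).trans ha)
      (hp0 (pick r k A hA))
    rw [← (hpick r k A hA).2.1, offerValue, listValue]
    linarith

end ThresholdBlock

/-! ### The block-responsive policy -/

/-- The block-responsive policy whose blocks follow the optimal offers of `pick` along the
all-reject path while the value after an acceptance drops by at most `δ` within the block. -/
noncomputable def nearConstantPolicy {p v : Fin n → ℝ} {cls : Fin n → ℕ}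
    {pick : ℕ → ℕ → (A : Finset (Fin n)) → A.Nonempty → Fin n}
    (hpick : IsOptimalPick p v cls pick) (δ : ℝ) (T : ℕ) : BlockPolicy n T where
  block t k A := thresholdBlock p v pick
    (acceptValue p v pick (T + 1 - t) (k - 1) A - δ) (T + 1 - t) (k - 1) A
  nodup _ _ _ _ := thresholdBlock_nodup hpick _ _ _ _
  available _ _ _ _ := thresholdBlock_subset hpick _ _ _ _
  length_le t k A h := by
    have h1 := thresholdBlock_length_le (p := p) (v := v) (pick := pick)
      (acceptValue p v pick (T + 1 - t) (k - 1) A - δ) (T + 1 - t) (k - 1) A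
    have h2 := h.1
    omega

section NearConstantPolicy

variable {p v : Fin n → ℝ} {cls : Fin n → ℕ}
  {pick : ℕ → ℕ → (A : Finset (Fin n)) → A.Nonempty → Fin n}

theorem nearConstantPolicy_block_ne_nil (hpick : IsOptimalPick p v cls pick) {δ : ℝ} (hδ : 0 ≤ δ)
    {T t k : ℕ} {A : Finset (Fin n)} (h : NonTerminal T t k A) :
    (nearConstantPolicy hpick δ T).block t k A ≠ [] := by
  obtain ⟨r, hr⟩ : ∃ r, T + 1 - t = r + 1 := ⟨T - t, by have := h.1; omega⟩
  simp only [nearConstantPolicy, hr]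
  rw [thresholdBlock_of_le h.2.2 (by linarith)]
  exact List.cons_ne_nil _ _

/-- Each acceptance costs the policy at most `δ` against the optimum. -/
theorem optValue_sub_le_expectation (hp0 : ∀ i, 0 ≤ p i) (hp1 : ∀ i, p i ≤ 1)
    (hv : ∀ i, 0 ≤ v i) (hpick : IsOptimalPick p v cls pick) {δ : ℝ} (hδ : 0 ≤ δ)
    (T t k : ℕ) (A : Finset (Fin n)) :
    optValue p v (T + 1 - t) k A - k * δ ≤
      expectation p fun ω => (nearConstantPolicy hpick δ T).sampleReward v ω t k A := by
  induction hr : T + 1 - t using Nat.strong_induction_on generalizing t k A with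
  | _ r ih =>
    by_cases hN : NonTerminal T t k A
    · have hne := nearConstantPolicy_block_ne_nil hpick hδ hN
      rw [BlockPolicy.expectation_sampleReward _ hN hne]
      obtain ⟨k, rfl⟩ : ∃ s, k = s + 1 := ⟨k - 1, by have := hN.2.1; omega⟩
      have hpos := List.length_pos_iff.2 hne
      have hT := hN.1
      set l := (nearConstantPolicy hpick δ T).block t (k + 1) A with hl
      have hl' : l = thresholdBlock p v pick (acceptValue p v pick r k A - δ) r k A := by
        simp [hl, nearConstantPolicy, hr]
      have hsub : T + 1 - (t + l.length) = r - l.length := by omega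
      have h1 := ih (r - l.length) (by omega) (t + l.length) k (A \ l.toFinset) hsub
      have h2 := ih (r - l.length) (by omega) (t + l.length) (k + 1) (A \ l.toFinset) hsub
      have h3 := le_optValue_of_thresholdBlock (p := p) (v := v) (pick := pick)
        (acceptValue p v pick r k A - δ) r k A (hl' ▸ hne)
      rw [← hl'] at h3
      rw [Nat.add_sub_cancel]
      have h4 := optValue_sub_le_listValue hp0 hp1 hv hpick
        (θ := acceptValue p v pick r k A - δ) (u := acceptValue p v pick r k A)
        (a := expectation p fun ω => (nearConstantPolicy hpick δ T).sampleReward v ω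
          (t + l.length) k (A \ l.toFinset))
        (s := expectation p fun ω => (nearConstantPolicy hpick δ T).sampleReward v ω
          (t + l.length) (k + 1) (A \ l.toFinset))
        (c := ((k + 1 : ℕ) : ℝ) * δ)
        (by push_cast; linarith) r k A le_rfl
      rw [← hl'] at h4
      exact h4 h2
    · have h0 : optValue p v r k A = 0 := by
        rcases r with _ | r
        · simp
        rcases k with _ | k
        · simp
        rcases A.eq_empty_or_nonempty with rfl | h
        · simp
        · exact absurd ⟨by omega, by omega, h⟩ hN
      simp only [BlockPolicy.sampleReward_of_leaf _ v _ (fun h => hN h.1), h0]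
      have : 0 ≤ (k : ℝ) * δ := by positivity
      simpa [expectation] using this

theorem BlockPolicy.treeFrom_of_leaf {T : ℕ} (H : BlockPolicy n T) {t k : ℕ} {A : Finset (Fin n)}
    (h : ¬ (NonTerminal T t k A ∧ H.block t k A ≠ [])) : H.treeFrom t k A = .leaf t k A := by
  rw [treeFrom, dif_neg h]

theorem BlockPolicy.treeFrom_of_internal {T : ℕ} (H : BlockPolicy n T) {t k : ℕ}
    {A : Finset (Fin n)} (h : NonTerminal T t k A ∧ H.block t k A ≠ []) :
    H.treeFrom t k A = .node t k A (H.block t k A)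
      (H.treeFrom (t + (H.block t k A).length) k (A \ (H.block t k A).toFinset))
      (H.treeFrom (t + (H.block t k A).length) (k - 1) (A \ (H.block t k A).toFinset)) := by
  rw [treeFrom, dif_pos h]

/-- Every rejection of a block lowers the value after an acceptance by more than `δ`, so if that
value is below `ℓ δ`, at most `ℓ` blocks are offered before the next acceptance; if it is
below `L δ` at all relevant states, then at most `L` blocks are offered between two acceptances. -/
theorem nearConstantPolicy_tree_bound (hp0 : ∀ i, 0 ≤ p i) (hp1 : ∀ i, p i ≤ 1)
    (hv : ∀ i, 0 ≤ v i) (hpick : IsOptimalPick p v cls pick) {δ : ℝ} (hδ : 0 < δ) {T K L : ℕ}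
    (hL : optValue p v T K univ < L * δ) (ℓ t k : ℕ) (A : Finset (Fin n)) (ht : 1 ≤ t)
    (hk : k < K) (hℓ : NonTerminal T t (k + 1) A →
      acceptValue p v pick (T + 1 - t) k A < ℓ * δ) :
    ((nearConstantPolicy hpick δ T).treeFrom t (k + 1) A).numNodes
        ≤ 1 + ℓ * (1 + (2 * L + 1) ^ k) ∧
      ((nearConstantPolicy hpick δ T).treeFrom t (k + 1) A).depth ≤ ℓ + k * L := by
  induction hr : T + 1 - t using Nat.strong_induction_on generalizing ℓ t k A with
  | _ r ih =>
    by_cases hN : NonTerminal T t (k + 1) A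
    · have hne := nearConstantPolicy_block_ne_nil hpick hδ.le hN
      have hpos := List.length_pos_iff.2 hne
      have hT := hN.1
      rw [BlockPolicy.treeFrom_of_internal _ ⟨hN, hne⟩]
      set l := (nearConstantPolicy hpick δ T).block t (k + 1) A with hl
      have hl' : l = thresholdBlock p v pick (acceptValue p v pick r k A - δ) r k A := by
        simp [hl, nearConstantPolicy, hr]
      have hsub : T + 1 - (t + l.length) = r - l.length := by omega
      have hX := hℓ hN
      rw [hr] at hX
      obtain ⟨ℓ, rfl⟩ : ∃ m, ℓ = m + 1 := by
        refine ⟨ℓ - 1, ?_⟩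
        have h0 := acceptValue_nonneg (pick := pick) hp0 hp1 hv r k A
        have : ℓ ≠ 0 := by
          rintro rfl
          simp at hX
          linarith
        omega
      have hleft := ih (r - l.length) (by omega) ℓ (t + l.length) k (A \ l.toFinset) (by omega) hk
        (fun hN' => by
          have h1 := acceptValue_lt_of_thresholdBlock (p := p) (v := v) (pick := pick)
            (acceptValue p v pick r k A - δ) r k A
          rw [← hl'] at h1
          have h2 := h1 (by have := hN'.1; omega) hN'.2.2
          rw [hsub]
          push_cast at hX
          linarith) hsub
      have hright : ((nearConstantPolicy hpick δ T).treeFrom (t + l.length) k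
            (A \ l.toFinset)).numNodes ≤ (2 * L + 1) ^ k ∧
          ((nearConstantPolicy hpick δ T).treeFrom (t + l.length) k
            (A \ l.toFinset)).depth ≤ k * L := by
        rcases k with _ | k
        · rw [BlockPolicy.treeFrom_of_leaf _ (fun h => by have := h.1.2.1; omega)]
          simp [BlockTree.numNodes, BlockTree.depth]
        · have h1 := ih (r - l.length) (by omega) L (t + l.length) k (A \ l.toFinset)
            (by omega) (by omega) (fun _ => lt_of_le_of_lt
              ((acceptValue_le hp0 hp1 hv _ _ _).trans
                (optValue_mono hp0 hp1 hv (by omega) (by omega) (Finset.subset_univ _))) hL) hsub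
          refine ⟨h1.1.trans ?_, h1.2.trans (by linarith)⟩
          have h2 : 1 ≤ (2 * L + 1) ^ k := Nat.one_le_pow _ _ (by omega)
          rw [pow_succ]
          nlinarith
      rw [Nat.add_sub_cancel, BlockTree.numNodes, BlockTree.depth]
      constructor
      · have := hleft.1
        have := hright.1
        rw [add_mul]
        omega
      · have := hleft.2
        have := hright.2
        have : max ((nearConstantPolicy hpick δ T).treeFrom (t + l.length) (k + 1)
            (A \ l.toFinset)).depth ((nearConstantPolicy hpick δ T).treeFrom (t + l.length) k
            (A \ l.toFinset)).depth ≤ ℓ + k * L := max_le (by omega) (by omega)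
        omega
    · rw [BlockPolicy.treeFrom_of_leaf _ (fun h => hN h.1)]
      simp [BlockTree.numNodes, BlockTree.depth]

theorem nearConstantPolicy_blockOrderByValue (hpick : IsOptimalPick p v cls pick) (δ : ℝ) (T : ℕ) :
    (nearConstantPolicy hpick δ T).BlockOrderByValue cls v := by
  intro t k A _ m i hi him j hj hjm hlt
  exact thresholdBlock_order hpick _ _ _ A i hi j hj (him.trans hjm.symm) hlt

end NearConstantPolicy

/-- The policy that makes no offers. -/
def emptyPolicy (n T : ℕ) : BlockPolicy n T where
  block _ _ _ := []
  nodup _ _ _ _ := List.nodup_nil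
  available _ _ _ _ := by simp
  length_le _ _ _ h := by simpa using h.1.trans (Nat.le_succ T)

theorem emptyPolicy_expectedReward (I : HiringInstance n) :
    (emptyPolicy n I.horizon).expectedReward I = 0 := by
  have : ∀ ω t k A, (emptyPolicy n I.horizon).sampleReward I.value ω t k A = 0 :=
    fun ω t k A => BlockPolicy.sampleReward_of_leaf _ _ _ (fun h => h.2 rfl)
  simp [BlockPolicy.expectedReward, this, expectation]

theorem emptyPolicy_decisionTree (I : HiringInstance n) :
    (emptyPolicy n I.horizon).decisionTree I = .leaf 1 I.positions univ :=
  BlockPolicy.treeFrom_of_leaf _ (fun h => h.2 rfl)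

/-! ### The mixed-rounded instance -/

namespace HiringInstance

variable {I : HiringInstance n} {ε : ℝ}

theorem gamma_pos (hT : 1 ≤ I.horizon) (hε : 0 < ε) : 0 < I.gamma ε :=
  div_pos hε (by exact_mod_cast hT)

theorem Valid.probUp_nonneg (hI : I.Valid) (hT : 1 ≤ I.horizon) (hε : 0 < ε) (i : Fin n) :
    0 ≤ I.probUp ε i := by
  unfold probUp
  split_ifs
  · exact (gamma_pos hT hε).le
  · exact hI.prob_nonneg i

theorem Valid.mixedRounded (hI : I.Valid) (hT : 1 ≤ I.horizon) (hε : 0 < ε) (hε1 : ε < 1) :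
    (I.mixedRounded ε).Valid where
  value_nonneg i := div_nonneg (mul_nonneg (hI.value_nonneg i) (hI.prob_nonneg i))
    (hI.probUp_nonneg hT hε i)
  prob_nonneg i := by
    have := gamma_pos hT hε
    change 0 ≤ I.probMixed ε i
    unfold probMixed
    split_ifs
    · exact hI.probUp_nonneg hT hε i
    · positivity
  prob_le_one i := by
    change I.probMixed ε i ≤ 1
    unfold probMixed
    split_ifs with h
    · rw [probUp, if_pos h, gamma, div_le_one (by exact_mod_cast hT)]
      exact hε1.le.trans (by exact_mod_cast hT)
    · obtain ⟨m, hm⟩ := Nat.exists_eq_succ_of_ne_zero h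
      have := ((I.classIndex_eq_succ_iff hε hT i m).1 hm).1
      rw [hm, Nat.succ_sub_one]
      exact this.le.trans (hI.prob_le_one i)

theorem mixedRounded_prob_congr (i j : Fin n) (h : I.classIndex ε i = I.classIndex ε j) :
    (I.mixedRounded ε).prob i = (I.mixedRounded ε).prob j := by
  change I.probMixed ε i = I.probMixed ε j
  simp only [probMixed, probUp, h]
  split_ifs <;> rfl

end HiringInstance

theorem HiringPolicy.expectedReward_le_optValue (H : HiringPolicy n) {I : HiringInstance n}
    (hI : I.Valid) :
    H.expectedReward I ≤ optValue I.prob I.value I.horizon I.positions univ := by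
  exact H.expectation_sampleReward_le (v := I.value) hI.prob_nonneg hI.prob_le_one
    I.horizon 1 I.positions univ

end SeqHiring

theorem mainTheorem3 :
    ∃ C : ℕ, ∀ (n : ℕ) (I : SeqHiring.HiringInstance n) (ε : ℝ),
      I.Valid → 1 ≤ I.horizon → 0 < ε → ε < 1 →
      ∀ Hopt : SeqHiring.HiringPolicy n, Hopt.IsOptimal (I.mixedRounded ε) →
      ∃ HB : SeqHiring.BlockPolicy n (I.mixedRounded ε).horizon,
        (1 - 4 * ε ^ 3 * (I.positions : ℝ)) * Hopt.expectedReward (I.mixedRounded ε)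
          ≤ HB.expectedReward (I.mixedRounded ε) ∧
        ((HB.decisionTree (I.mixedRounded ε)).numNodes : ℝ) ≤ (1 / ε) ^ (C * I.positions) ∧
        ((HB.decisionTree (I.mixedRounded ε)).depth : ℝ)
          ≤ C * ((I.positions : ℝ) / ε ^ 3 * Real.log (1 / ε)) ∧
        HB.BlockOrderByValue (I.classIndex ε) (I.mixedRounded ε).value := by
  refine ⟨6, fun n I ε hI hT hε hε1 Hopt _ => ?_⟩
  have hJ := hI.mixedRounded hT hε hε1
  set J := I.mixedRounded ε
  set k := I.positions
  have hJk : J.positions = k := rfl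
  have hε3 : 0 < ε ^ 3 := by positivity
  have hinv : 1 ≤ 1 / ε := (one_le_div hε).2 hε1.le
  have hlog0 : 0 ≤ Real.log (1 / ε) := Real.log_nonneg hinv
  have hle := Hopt.expectedReward_le_optValue hJ
  have hnn : 0 ≤ Hopt.expectedReward J :=
    SeqHiring.expectation_nonneg hJ.prob_nonneg hJ.prob_le_one
      fun ω => Hopt.sampleReward_nonneg hJ.value_nonneg _ _ _ _ _
  set V := SeqHiring.optValue J.prob J.value J.horizon J.positions Finset.univ with hV
  -- If the required reward is not positive, then no offer has to be made.
  by_cases htriv : (1 - 4 * ε ^ 3 * (k : ℝ)) * Hopt.expectedReward J ≤ 0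
  · refine ⟨SeqHiring.emptyPolicy n J.horizon, ?_, ?_, ?_, ?_⟩
    · rwa [SeqHiring.emptyPolicy_expectedReward]
    · rw [SeqHiring.emptyPolicy_decisionTree]
      simpa [SeqHiring.BlockTree.numNodes] using one_le_pow₀ (n := 6 * k) hinv
    · rw [SeqHiring.emptyPolicy_decisionTree]
      simp only [SeqHiring.BlockTree.depth, Nat.cast_zero]
      positivity
    · intro t k A _ m i _ _ j hj
      simp [SeqHiring.emptyPolicy] at hj
  push Not at htriv
  have hcoef : 0 < 1 - 4 * ε ^ 3 * (k : ℝ) := by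
    by_contra h
    exact absurd htriv (not_lt.2 (mul_nonpos_of_nonpos_of_nonneg (not_lt.1 h) hnn))
  have hVpos : 0 < V := lt_of_lt_of_le (by
    by_contra h
    exact absurd htriv (not_lt.2 (mul_nonpos_of_nonneg_of_nonpos hcoef.le (not_lt.1 h)))) hle
  have hkpos : 1 ≤ k := by
    by_contra h
    have h0 : J.positions = 0 := by omega
    rw [hV, h0, SeqHiring.optValue_zero_right] at hVpos
    exact lt_irrefl _ hVpos
  have hk1 : (1 : ℝ) ≤ k := by exact_mod_cast hkpos
  -- This bound keeps `1 / ε` away from `1`, so that its powers absorb constant factors.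
  have hε4 : 4 * ε ^ 3 < 1 := by nlinarith
  obtain ⟨pick, hpick⟩ := SeqHiring.exists_isOptimalPick J.value hJ.prob_nonneg hJ.prob_le_one
    (cls := I.classIndex ε) SeqHiring.HiringInstance.mixedRounded_prob_congr
  have hδ : 0 < ε ^ 3 * V := by positivity
  set x : ℝ := 1 / ε ^ 3 with hx
  have hx4 : 4 ≤ x := by rw [hx, le_div_iff₀ hε3]; exact hε4.le
  obtain ⟨L, hL⟩ : ∃ L : ℕ, L = ⌊x⌋₊ + 1 := ⟨_, rfl⟩
  have hLx : x < L := by rw [hL]; exact_mod_cast Nat.lt_floor_add_one x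
  have hLx' : (L : ℝ) ≤ x + 1 := by
    rw [hL]; push_cast
    linarith [Nat.floor_le (by linarith : 0 ≤ x)]
  have hLδ : V < L * (ε ^ 3 * V) := by
    have h1 : x * ε ^ 3 = 1 := by rw [hx]; field_simp
    have h2 := mul_lt_mul_of_pos_right hLx hδ
    nlinarith
  have htree := SeqHiring.nearConstantPolicy_tree_bound hJ.prob_nonneg hJ.prob_le_one
    hJ.value_nonneg hpick hδ hLδ L 1 (k - 1) Finset.univ le_rfl (by omega) (fun _ =>
      lt_of_le_of_lt ((SeqHiring.acceptValue_le hJ.prob_nonneg hJ.prob_le_one hJ.value_nonneg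
        _ _ _).trans (SeqHiring.optValue_mono hJ.prob_nonneg hJ.prob_le_one hJ.value_nonneg
          (by omega) (by omega) (Finset.subset_univ _))) hLδ)
  rw [Nat.sub_add_cancel hkpos] at htree
  refine ⟨SeqHiring.nearConstantPolicy hpick (ε ^ 3 * V) J.horizon, ?_, ?_, ?_,
    SeqHiring.nearConstantPolicy_blockOrderByValue hpick _ _⟩
  · have h1 := SeqHiring.optValue_sub_le_expectation hJ.prob_nonneg hJ.prob_le_one
      hJ.value_nonneg hpick hδ.le J.horizon 1 k Finset.univ
    rw [Nat.add_sub_cancel] at h1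
    refine le_trans ?_ h1
    change _ ≤ V - k * (ε ^ 3 * V)
    have h2 := mul_le_mul_of_nonneg_left hle hcoef.le
    have h3 : 0 ≤ 3 * ε ^ 3 * (k : ℝ) * V := by positivity
    linarith
  · have h1 : ((SeqHiring.nearConstantPolicy hpick (ε ^ 3 * V) J.horizon).decisionTree
        J).numNodes ≤ (2 * L + 1) ^ k := by
      refine htree.1.trans ?_
      obtain ⟨m, hm⟩ : ∃ m, k = m + 1 := ⟨k - 1, by omega⟩
      have h2 : 1 ≤ (2 * L + 1) ^ m := Nat.one_le_pow _ _ (by omega)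
      rw [hm, Nat.add_sub_cancel, pow_succ]
      nlinarith
    have h2 : (2 * L + 1 : ℝ) ≤ (1 / ε) ^ 6 := by
      have h3 : (1 / ε) ^ 6 = x ^ 2 := by rw [hx]; field_simp
      rw [h3]
      nlinarith
    rw [pow_mul]
    refine le_trans (by exact_mod_cast h1) (pow_le_pow_left₀ (by positivity) h2 k)
  · have h1 : ((SeqHiring.nearConstantPolicy hpick (ε ^ 3 * V) J.horizon).decisionTree
        J).depth ≤ k * L := by
      refine htree.2.trans ?_
      obtain ⟨m, hm⟩ : ∃ m, k = m + 1 := ⟨k - 1, by omega⟩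
      rw [hm, Nat.add_sub_cancel]
      linarith
    have hεle : ε ≤ 2 / 3 := by
      by_contra h
      have := pow_lt_pow_left₀ (not_le.1 h) (by norm_num) (n := 3) (by norm_num)
      norm_num at this
      linarith
    have hlog : 1 / 3 ≤ Real.log (1 / ε) := by
      have := Real.one_sub_inv_le_log_of_pos (show 0 < 1 / ε by positivity)
      simp only [one_div, inv_inv] at this ⊢
      linarith
    have h2 : (L : ℝ) ≤ 6 * (x * Real.log (1 / ε)) := by nlinarith
    calc (_ : ℝ) ≤ ((k * L : ℕ) : ℝ) := by exact_mod_cast h1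
      _ = k * L := by push_cast; ring
      _ ≤ k * (6 * (x * Real.log (1 / ε))) := by gcongr
      _ = _ := by rw [hx]; push_cast; ring
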